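/- Let $A,B$ be $n\times n$ complex Hermitian matrices. For $z\in\mathbb C$ consider $A-zB$, and put $A-\infty B:=B$. Let $r=\max_{z\in\mathbb C\cup\{\infty\}}\operatorname{rank}(A-zB)$ be the normal rank of the pencil $A-zB$ (the pencil may be singular, that is, $r<n$). A point $\lambda\in\mathbb C\cup\{\infty\}$ is an eigenvalue of the pencil if $\operatorname{rank}(A-\lambda B)<r$; its geometric multiplicity is $r-\operatorname{rank}(A-\lambda B)$. The algebraic multiplicity of a real eigenvalue $t_0$ is the sum of the multiplicities of $t_0$ as a zero of those real-analytic eigenfunctions $\lambda_1(t),\dots,\lambda_n(t)$ of the Hermitian matrix $A-tB$, $t\in\mathbb R$, that are not identically zero; equivalently, it is the multiplicity of $t_0$ as a zero of their product, which is, up to sign, the lowest nonzero coefficient (a polynomial in $t$) of $\det(xI-(A-tB))$ viewed as a polynomial in $x$. For a Hermitian matrix $M$, let $n_+(M)$ and $n_-(M)$ be the numbers of its positive and negative eigenvalues, with multiplicity. For real $a<b$, let $n_{(a,b)}(A,B)$ be the number of eigenvalues of the pencil in $(a,b)$, and let $n_{\mathbb R}(A,B)$ be the number of its finite real eigenvalues,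 both counted with algebraic multiplicity. Suppose that $B$ has exactly $n-k$ positive eigenvalues, where $k\ge 0$ and $n\ge 2k$. Then: (i) If $a<b$ are real numbers, neither of which is an eigenvalue of the pencil $A-zB$, then $$n_{(a,b)}(A,B)=|n_+(A-aB)-n_+(A-bB)|+2h\quad\text{for some } h\in\{0,1,\dots,k\}.$$ (ii) Let $g_\infty=r-\operatorname{rank}B$ be the geometric multiplicity of $\infty$ (zero if $\infty$ is not an eigenvalue). Then $$|n_+(B)-n_-(B)|-g_\infty\le n_{\mathbb R}(A,B)\le n.$$ In particular, if $\infty$ is not an eigenvalue of the pencil (for instance, if $B$ is nonsingular), then $|n_+(B)-n_-(B)|\le n_{\mathbb R}(A,B)\le n$. -/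

import Mathlib

/-- The number `n₊(M)` of positive eigenvalues of a Hermitian matrix, with multiplicity. -/
noncomputable def nPos {n : ℕ} {M : Matrix (Fin n) (Fin n) ℂ} (hM : M.IsHermitian) : ℕ :=
  (Finset.univ.filter fun i => 0 < hM.eigenvalues i).card

/-- The number `n₋(M)` of negative eigenvalues of a Hermitian matrix, with multiplicity. -/
noncomputable def nNeg {n : ℕ} {M : Matrix (Fin n) (Fin n) ℂ} (hM : M.IsHermitian) : ℕ :=
  (Finset.univ.filter fun i => hM.eigenvalues i < 0).card

/-- The value `A - z B` of the pencil at a point `z` of `ℂ ∪ {∞}`, with `A - ∞ B := B`. -/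
def pencilAt {n : ℕ} (A B : Matrix (Fin n) (Fin n) ℂ) : OnePoint ℂ → Matrix (Fin n) (Fin n) ℂ
  | none => B
  | some z => A - z • B

/-- For Hermitian `A`, `B` and real `t`, the matrix `A - t B` is Hermitian. -/
theorem isHermitian_pencil {n : ℕ} {A B : Matrix (Fin n) (Fin n) ℂ}
    (hA : A.IsHermitian) (hB : B.IsHermitian) (t : ℝ) :
    (A - (t : ℂ) • B).IsHermitian := by
  refine hA.sub ?_
  rw [Matrix.IsHermitian, Matrix.conjTranspose_smul, hB.eq]
  simp

/-- The normal rank `max {rank (A - z B) : z ∈ ℂ ∪ {∞}}` of the pencil. -/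
noncomputable def normalRank {n : ℕ} (A B : Matrix (Fin n) (Fin n) ℂ) : ℕ :=
  ⨆ z : OnePoint ℂ, (pencilAt A B z).rank

/-- `z ∈ ℂ ∪ {∞}` is an eigenvalue of the (possibly singular) pencil if the rank drops at `z`. -/
def IsPencilEigenvalue {n : ℕ} (A B : Matrix (Fin n) (Fin n) ℂ) (z : OnePoint ℂ) : Prop :=
  (pencilAt A B z).rank < normalRank A B

/-- The geometric multiplicity of `z ∈ ℂ ∪ {∞}`: the rank drop at `z` (zero if `z` is not an
eigenvalue). -/
noncomputable def geomMult {n : ℕ} (A B : Matrix (Fin n) (Fin n) ℂ) (z : OnePoint ℂ) : ℕ :=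
  normalRank A B - (pencilAt A B z).rank

/-- `A - z B` as a matrix of polynomials in `z`. -/
noncomputable def pencilMatrix {n : ℕ} (A B : Matrix (Fin n) (Fin n) ℂ) :
    Matrix (Fin n) (Fin n) (Polynomial ℂ) :=
  A.map Polynomial.C - (Polynomial.X : Polynomial ℂ) • B.map Polynomial.C

/-- Up to sign, the product of those eigenfunctions of `t ↦ A - t B` that are not identically zero:
the lowest nonzero coefficient of the characteristic polynomial
`det (x I - (A - z B)) ∈ ℂ[z][x]`, which is a nonzero polynomial in `z`. -/
noncomputable def eigenfunctionProd {n : ℕ} (A B : Matrix (Fin n) (Fin n) ℂ) : Polynomial ℂ :=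
  (pencilMatrix A B).charpoly.trailingCoeff

/-- The algebraic multiplicity of a real point `t` for the Hermitian pencil `A - z B`: the sum of
the multiplicities of `t` as a zero of the eigenfunctions that are not identically zero, that is,
the multiplicity of `t` as a zero of their product. See `algMult_eq_sum_order`. -/
noncomputable def algMult {n : ℕ} (A B : Matrix (Fin n) (Fin n) ℂ) (t : ℝ) : ℕ :=
  (eigenfunctionProd A B).rootMultiplicity (t : ℂ)

/-- The number of real eigenvalues of the pencil in `S ⊆ ℝ`, counted with algebraic multiplicity. -/
noncomputable def nEig {n : ℕ} (A B : Matrix (Fin n) (Fin n) ℂ) (S : Set ℝ) : ℕ :=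
  ∑ᶠ t ∈ {t : ℝ | t ∈ S ∧ IsPencilEigenvalue A B (((t : ℂ) : OnePoint ℂ))}, algMult A B t

/-- `f 0, …, f (n-1)` are (Rellich's) analytic eigenfunctions of `t ↦ A - t B`, `t ∈ ℝ`. -/
def IsEigenfunctions {n : ℕ} (A B : Matrix (Fin n) (Fin n) ℂ) (f : Fin n → ℝ → ℝ) : Prop :=
  (∀ i, AnalyticOnNhd ℝ (f i) Set.univ) ∧
    ∀ t : ℝ, (A - (t : ℂ) • B).charpoly =
      ∏ i, (Polynomial.X - Polynomial.C ((f i t : ℝ) : ℂ))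

/-- The algebraic multiplicity is the sum of the multiplicities of the zeros of the eigenfunctions
that are not identically zero. -/
theorem algMult_eq_sum_order {n : ℕ} {A B : Matrix (Fin n) (Fin n) ℂ} {f : Fin n → ℝ → ℝ}
    (hf : IsEigenfunctions A B f) (t : ℝ) [DecidablePred fun i => f i ≠ 0] :
    algMult A B t = ∑ i with f i ≠ 0, analyticOrderNatAt (f i) t := by
  obtain ⟨hfa, hfc⟩ := hf
  set S : Finset (Fin n) := Finset.univ.filter fun i => f i ≠ 0 with hS
  set p := (pencilMatrix A B).charpoly with hp
  set m := (Finset.univ.filter fun i => ¬ f i ≠ 0).card with hm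
  have hmap : ∀ s : ℝ, p.map (Polynomial.evalRingHom (s : ℂ)) =
      Polynomial.X ^ m * ∏ i ∈ S, (Polynomial.X - Polynomial.C ((f i s : ℝ) : ℂ)) := by
    intro s
    rw [hp, ← Matrix.charpoly_map]
    have h1 : (pencilMatrix A B).map (Polynomial.evalRingHom (s : ℂ)) = A - (s : ℂ) • B := by
      ext i j; simp [pencilMatrix]; exact mul_comm _ _
    rw [h1, hfc s, ← Finset.prod_filter_mul_prod_filter_not Finset.univ (fun i => f i ≠ 0),
      mul_comm]
    congr 1
    rw [hm, Finset.prod_congr rfl (g := fun _ => Polynomial.X), Finset.prod_const]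
    intro i hi
    have : f i = 0 := by simpa using hi
    simp [this]
  have hev : ∀ (s : ℝ) (j : ℕ), (p.coeff j).eval (s : ℂ) = (Polynomial.X ^ m *
      ∏ i ∈ S, (Polynomial.X - Polynomial.C ((f i s : ℝ) : ℂ))).coeff j := by
    intro s j
    rw [← hmap s, Polynomial.coeff_map]; rfl
  have hlow : ∀ j < m, p.coeff j = 0 := by
    intro j hj
    refine Polynomial.eq_zero_of_infinite_isRoot _
      (Set.Infinite.mono ?_ (Set.infinite_range_of_injective Complex.ofReal_injective))
    rintro _ ⟨s, rfl⟩
    show (p.coeff j).eval (s : ℂ) = 0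
    rw [hev, Polynomial.coeff_X_pow_mul', if_neg (not_le.2 hj)]
  have hmid : ∀ s : ℝ, (p.coeff m).eval (s : ℂ) = ∏ i ∈ S, (-((f i s : ℝ) : ℂ)) := by
    intro s
    rw [hev, Polynomial.coeff_X_pow_mul', if_pos le_rfl, Nat.sub_self,
      Polynomial.coeff_zero_eq_eval_zero, Polynomial.eval_prod]
    simp
  have hloc : ∀ i ∈ S, ∃ g : ℝ → ℝ, AnalyticAt ℝ g t ∧ g t ≠ 0 ∧ ∀ᶠ s in nhds t,
      f i s = (s - t) ^ analyticOrderNatAt (f i) t * g s := by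
    intro i hi
    have hi' : f i ≠ 0 := by simpa [hS] using hi
    have hne : analyticOrderAt (f i) t ≠ ⊤ := by
      intro htop
      apply hi'
      rw [analyticOrderAt_eq_top] at htop
      exact (hfa i).eq_of_eventuallyEq (g := 0) (fun _ _ => analyticAt_const) htop
    have := (hfa i t (Set.mem_univ t)).analyticOrderAt_ne_top.1 hne
    exact this
  choose! g hga hgne hg using hloc
  set N := ∑ i ∈ S, analyticOrderNatAt (f i) t with hN
  have hEv : ∀ᶠ s in nhds t, (p.coeff m).eval ((s : ℝ) : ℂ) =
      (s - t) ^ N • ∏ i ∈ S, (-((g i s : ℝ) : ℂ)) := by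
    have h2 : ∀ᶠ s in nhds t, ∀ i ∈ S, f i s = (s - t) ^ analyticOrderNatAt (f i) t * g i s :=
      (Finset.eventually_all S).2 hg
    filter_upwards [h2] with s hs
    rw [hmid, hN, ← Finset.prod_pow_eq_pow_sum, Complex.real_smul, Complex.ofReal_prod,
      ← Finset.prod_mul_distrib]
    refine Finset.prod_congr rfl fun i hi => ?_
    rw [hs i hi]; push_cast; ring
  have hofReal : ∀ s : ℝ, AnalyticAt ℝ (fun x : ℝ => (x : ℂ)) s := fun s =>
    Complex.ofRealCLM.analyticAt s
  have hpoly : ∀ q : Polynomial ℂ, AnalyticAt ℝ (fun s : ℝ => q.eval (s : ℂ)) t := by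
    intro q
    induction q using Polynomial.induction_on' with
    | add a b ha hb => simpa [Pi.add_def] using ha.add hb
    | monomial k c =>
      simpa [Pi.mul_def, Pi.pow_def] using (analyticAt_const (v := c)).mul ((hofReal t).pow k)
  have hord1 : analyticOrderAt (fun s : ℝ => (p.coeff m).eval (s : ℂ)) t = N := by
    rw [(hpoly _).analyticOrderAt_eq_natCast]
    refine ⟨fun s => ∏ i ∈ S, (-((g i s : ℝ) : ℂ)), ?_, ?_, hEv⟩
    · have : ∀ i ∈ S, AnalyticAt ℝ (fun s => -((g i s : ℝ) : ℂ)) t := fun i hi =>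
        ((hofReal _).comp (hga i hi)).neg
      exact Finset.analyticAt_fun_prod S this
    · exact Finset.prod_ne_zero_iff.2 fun i hi => by simpa using hgne i hi
  have hq0 : p.coeff m ≠ 0 := by
    intro h
    have : analyticOrderAt (fun s : ℝ => (p.coeff m).eval (s : ℂ)) t = ⊤ := by
      rw [analyticOrderAt_eq_top]; simp [h]
    rw [this] at hord1
    exact ENat.natCast_ne_top _ hord1.symm
  have htr : eigenfunctionProd A B = p.coeff m := by
    have hdeg : p.natTrailingDegree = m :=
      le_antisymm (Polynomial.natTrailingDegree_le_of_ne_zero hq0)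
        (Polynomial.le_natTrailingDegree (fun h => hq0 (by simp [h])) fun j hj => hlow j hj)
    rw [eigenfunctionProd, Polynomial.trailingCoeff, ← hp, hdeg]
  have hord2 : analyticOrderAt (fun s : ℝ => (p.coeff m).eval (s : ℂ)) t =
      (algMult A B t : ℕ) := by
    rw [(hpoly _).analyticOrderAt_eq_natCast, algMult, htr]
    obtain ⟨r, hr, hr2⟩ := Polynomial.exists_eq_pow_rootMultiplicity_mul_and_not_dvd
      (p.coeff m) hq0 (t : ℂ)
    refine ⟨fun s => r.eval (s : ℂ), hpoly r, fun h => hr2 (Polynomial.dvd_iff_isRoot.2 h),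
      Filter.Eventually.of_forall fun s => ?_⟩
    conv_lhs => rw [hr]
    simp [Complex.real_smul]
  rw [hord2] at hord1
  exact_mod_cast hord1

/-! Write `n₊(t)`, `n₋(t)` for the inertia of `A - tB`, and `q` for `eigenfunctionProd A B`. Three
facts about real `t` carry the proof.

Jumps: `n₊` and `n₋` are lower semicontinuous and their sum is a rank, at most `r`. So near `c` the
value of `n₊` exceeds `n₊(c)` by at most the rank drop at `c`, which is at most the algebraic
multiplicity. Hence `|n₊(a) - n₊(b)|` is at most the number of eigenvalues in `(a,b)`
(`abs_nPos_sub_nPos_le_nEig`).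

Parity: off the eigenvalues `q(t)` has sign `(-1)^n₊(t)`, so the difference of these two numbers is
even (`even_nEig_add`).

Degree: `deg q ≤ r` bounds the number of all real eigenvalues. For large `T` the inertia at `±T` is
controlled by that of `B`, which forces at least `n₊(B) - n₊(a)` eigenvalues in `(-T,a)` and at
least `n₊(b) + n₊(B) - r` in `(b,T)`. What is left for `(a,b)` is at most `n₊(a) - n₊(b) + 2(r -
n₊(B))`, and `r - n₊(B) ≤ k`. The jump bound on `(-T,T)` gives (ii).

Analytic eigenfunctions are not needed: everything is read off from `q`. -/

/-! ### Inertia of Hermitian matrices and its semicontinuity -/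

/-- The real part of the sesquilinear form `v ↦ v* M v`. -/
noncomputable def hermForm {n : ℕ} (M : Matrix (Fin n) (Fin n) ℂ) (v : Fin n → ℂ) : ℝ :=
  (star v ⬝ᵥ (M.mulVec v)).re

/-- The number of indices `i` with `0 < ε * λᵢ`, where the `λᵢ` are the eigenvalues of `M`: the
number of positive (negative) eigenvalues if `ε` is positive (negative). -/
noncomputable def signCount {n : ℕ} {M : Matrix (Fin n) (Fin n) ℂ} (hM : M.IsHermitian)
    (ε : ℝ) : ℕ :=
  Fintype.card {i // 0 < ε * hM.eigenvalues i}

/-- The coordinates of a vector in the eigenvector basis of a Hermitian matrix. -/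
noncomputable def eigenCoords {n : ℕ} {M : Matrix (Fin n) (Fin n) ℂ} (hM : M.IsHermitian) :
    Matrix (Fin n) (Fin n) ℂ :=
  star (hM.eigenvectorUnitary : Matrix (Fin n) (Fin n) ℂ)

theorem eigenCoords_mul {n : ℕ} {M : Matrix (Fin n) (Fin n) ℂ} (hM : M.IsHermitian) :
    eigenCoords hM * (hM.eigenvectorUnitary : Matrix (Fin n) (Fin n) ℂ) = 1 :=
  Unitary.coe_star_mul_self _

theorem mul_eigenCoords {n : ℕ} {M : Matrix (Fin n) (Fin n) ℂ} (hM : M.IsHermitian) :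
    (hM.eigenvectorUnitary : Matrix (Fin n) (Fin n) ℂ) * eigenCoords hM = 1 :=
  Unitary.coe_mul_star_self _

theorem eq_mul_diagonal_mul {n : ℕ} {M : Matrix (Fin n) (Fin n) ℂ} (hM : M.IsHermitian) :
    M = (hM.eigenvectorUnitary : Matrix (Fin n) (Fin n) ℂ) *
      Matrix.diagonal (fun i => ((hM.eigenvalues i : ℝ) : ℂ)) * eigenCoords hM := by
  have h := hM.spectral_theorem
  rwa [Unitary.conjStarAlgAut_apply] at h

theorem hermForm_eq_sum {n : ℕ} {M : Matrix (Fin n) (Fin n) ℂ} (hM : M.IsHermitian)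
    (v : Fin n → ℂ) :
    hermForm M v = ∑ i, hM.eigenvalues i * Complex.normSq ((eigenCoords hM).mulVec v i) := by
  have h1 : star v ⬝ᵥ (M.mulVec v) = star ((eigenCoords hM).mulVec v) ⬝ᵥ
      (Matrix.diagonal (fun i => ((hM.eigenvalues i : ℝ) : ℂ))).mulVec
        ((eigenCoords hM).mulVec v) := by
    conv_lhs => rw [eq_mul_diagonal_mul hM]
    rw [Matrix.star_mulVec, Matrix.dotProduct_mulVec, Matrix.dotProduct_mulVec,
      Matrix.dotProduct_mulVec, Matrix.vecMul_vecMul, Matrix.vecMul_vecMul, ← Matrix.mul_assoc,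
      ← Matrix.star_eq_conjTranspose, eigenCoords, star_star]
  rw [hermForm, h1, dotProduct, Complex.re_sum]
  refine Finset.sum_congr rfl fun i _ => ?_
  rw [Matrix.mulVec_diagonal, Pi.star_apply, Complex.star_def, mul_left_comm,
    Complex.conj_mul', ← Complex.ofReal_pow, ← Complex.ofReal_mul, Complex.ofReal_re,
    Complex.normSq_eq_norm_sq]

/-- If `ε` times the form of `M` is positive definite on the image of an `n × ι` matrix, then `M`
has at least `card ι` eigenvalues of the sign of `ε`. -/
theorem card_le_signCount {n : ℕ} {ι : Type*} [Fintype ι] {M : Matrix (Fin n) (Fin n) ℂ}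
    (hM : M.IsHermitian) (ε : ℝ) (P : Matrix (Fin n) ι ℂ)
    (hP : ∀ v ≠ 0, 0 < ε * hermForm M (P.mulVec v)) :
    Fintype.card ι ≤ signCount hM ε := by
  classical
  let L : (ι → ℂ) →ₗ[ℂ] ({i // 0 < ε * hM.eigenvalues i} → ℂ) :=
    ((eigenCoords hM * P).submatrix Subtype.val id).mulVecLin
  -- A kernel vector has no coordinate on eigenvectors with `0 < ε * λᵢ`, so `ε` times its form is a
  -- sum of nonpositive terms.
  have hL : Function.Injective L := by
    rw [← LinearMap.ker_eq_bot, LinearMap.ker_eq_bot']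
    intro v hv
    by_contra hne
    have h1 := hP v hne
    rw [hermForm_eq_sum hM, Finset.mul_sum] at h1
    refine absurd h1 (not_lt.2 (Finset.sum_nonpos fun i _ => ?_))
    rw [← mul_assoc]
    by_cases hi : 0 < ε * hM.eigenvalues i
    · have h2 : (eigenCoords hM).mulVec (P.mulVec v) i = 0 := by
        rw [Matrix.mulVec_mulVec]
        exact congrFun hv ⟨i, hi⟩
      simp [h2]
    · exact mul_nonpos_of_nonpos_of_nonneg (not_lt.1 hi) (Complex.normSq_nonneg _)
  have := LinearMap.finrank_le_finrank_of_injective hL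
  simpa [signCount] using this

/-- The columns of `P` are the eigenvectors for the chosen sign. Together with `card_le_signCount`
this makes `signCount` the largest dimension of a definite subspace. -/
theorem exists_hermForm_pos {n : ℕ} {M : Matrix (Fin n) (Fin n) ℂ}
    (hM : M.IsHermitian) (ε : ℝ) :
    ∃ P : Matrix (Fin n) {i // 0 < ε * hM.eigenvalues i} ℂ,
      ∀ v ≠ 0, 0 < ε * hermForm M (P.mulVec v) := by
  classical
  refine ⟨(hM.eigenvectorUnitary : Matrix (Fin n) (Fin n) ℂ) *
    (1 : Matrix (Fin n) (Fin n) ℂ).submatrix id Subtype.val, fun v hv => ?_⟩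
  rw [hermForm_eq_sum hM, Finset.mul_sum, Matrix.mulVec_mulVec, ← Matrix.mul_assoc,
    eigenCoords_mul, Matrix.one_mul]
  have key : ∀ i, ((1 : Matrix (Fin n) (Fin n) ℂ).submatrix id
      (Subtype.val : {i // 0 < ε * hM.eigenvalues i} → Fin n)).mulVec v i =
      if h : 0 < ε * hM.eigenvalues i then v ⟨i, h⟩ else 0 := by
    intro i
    simp only [Matrix.mulVec, dotProduct, Matrix.submatrix_apply, id, Matrix.one_apply, ite_mul,
      one_mul, zero_mul]
    split_ifs with h
    · rw [Finset.sum_eq_single ⟨i, h⟩]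
      · simp
      · intro b _ hb
        rw [if_neg]
        rintro rfl
        exact hb rfl
      · simp
    · refine Finset.sum_eq_zero fun b _ => if_neg ?_
      rintro rfl
      exact h b.2
  obtain ⟨j, hj⟩ := Function.ne_iff.1 hv
  refine Finset.sum_pos' (fun i _ => ?_) ⟨j.1, Finset.mem_univ _, ?_⟩
  · rw [key, ← mul_assoc]
    split_ifs with h
    · exact mul_nonneg h.le (Complex.normSq_nonneg _)
    · simp
  · rw [key, dif_pos j.2, ← mul_assoc]
    exact mul_pos j.2 (Complex.normSq_pos.2 hj)

theorem hermForm_real_smul {n : ℕ} (c : ℝ) (M : Matrix (Fin n) (Fin n) ℂ) (v : Fin n → ℂ) :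
    hermForm ((c : ℂ) • M) v = c * hermForm M v := by
  simp [hermForm, Matrix.smul_mulVec]

theorem hermForm_smul_vec {n : ℕ} (c : ℂ) (M : Matrix (Fin n) (Fin n) ℂ) (v : Fin n → ℂ) :
    hermForm M (c • v) = Complex.normSq c * hermForm M v := by
  rw [hermForm, hermForm, Matrix.mulVec_smul, star_smul, smul_dotProduct, dotProduct_smul,
    smul_smul, smul_eq_mul, Complex.star_def, mul_comm _ c, Complex.mul_conj, Complex.re_ofReal_mul]

theorem signCount_le_of_eq_smul {n : ℕ} {M N : Matrix (Fin n) (Fin n) ℂ} (hM : M.IsHermitian)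
    (hN : N.IsHermitian) (c ε : ℝ) (h : N = (c : ℂ) • M) :
    signCount hM (ε * c) ≤ signCount hN ε := by
  obtain ⟨P, hP⟩ := exists_hermForm_pos hM (ε * c)
  refine card_le_signCount hN ε P fun v hv => ?_
  rw [h, hermForm_real_smul, ← mul_assoc]
  exact hP v hv

/-- Lower semicontinuity of the number of eigenvalues of a given sign. -/
theorem eventually_signCount_le {n : ℕ} (M : ℝ → Matrix (Fin n) (Fin n) ℂ) (hc : Continuous M)
    (hM : ∀ t, (M t).IsHermitian) (ε : ℝ) (c : ℝ) :
    ∀ᶠ t in nhds c, signCount (hM c) ε ≤ signCount (hM t) ε := by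
  obtain ⟨P, hP⟩ := exists_hermForm_pos (hM c) ε
  have hcont : Continuous fun x : ℝ × ({i // 0 < ε * (hM c).eigenvalues i} → ℂ) =>
      ε * hermForm (M x.1) (P.mulVec x.2) := by
    unfold hermForm
    refine continuous_const.mul (Complex.continuous_re.comp ?_)
    have h2 : Continuous fun x : ℝ × ({i // 0 < ε * (hM c).eigenvalues i} → ℂ) =>
        P.mulVec x.2 := continuous_const.matrix_mulVec continuous_snd
    exact h2.star.dotProduct ((hc.comp continuous_fst).matrix_mulVec h2)
  -- The subspace stays fixed while `t` varies: positivity on its compact unit sphere persists for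
  -- `t` near `c`, and homogeneity extends it to all nonzero vectors.
  have hev := (isCompact_sphere (0 : {i // 0 < ε * (hM c).eigenvalues i} → ℂ)
    1).eventually_forall_of_forall_eventually (x₀ := c)
    (P := fun t v => 0 < ε * hermForm (M t) (P.mulVec v)) (fun v hv => by
      refine (isOpen_lt continuous_const hcont).mem_nhds ?_
      refine hP v ?_
      rintro rfl
      simp at hv)
  filter_upwards [hev] with t ht
  refine card_le_signCount (hM t) ε P fun v hv => ?_
  have hn : ‖v‖ ≠ 0 := norm_ne_zero_iff.2 hv
  have h1 := ht (((‖v‖⁻¹ : ℝ) : ℂ) • v) (by simp [norm_smul, hn])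
  rw [Matrix.mulVec_smul, hermForm_smul_vec, mul_left_comm] at h1
  exact pos_of_mul_pos_right h1 (Complex.normSq_nonneg _)

theorem nPos_eq_signCount {n : ℕ} {M : Matrix (Fin n) (Fin n) ℂ} (hM : M.IsHermitian) {ε : ℝ}
    (hε : 0 < ε) : nPos hM = signCount hM ε := by
  simp [nPos, signCount, Fintype.card_subtype, mul_pos_iff_of_pos_left hε]

theorem nNeg_eq_signCount {n : ℕ} {M : Matrix (Fin n) (Fin n) ℂ} (hM : M.IsHermitian) {ε : ℝ}
    (hε : ε < 0) : nNeg hM = signCount hM ε := by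
  simp [nNeg, signCount, Fintype.card_subtype, mul_pos_iff, hε, not_lt_of_gt hε]

theorem nPos_add_nNeg {n : ℕ} {M : Matrix (Fin n) (Fin n) ℂ} (hM : M.IsHermitian) :
    nPos hM + nNeg hM = M.rank := by
  rw [hM.rank_eq_card_non_zero_eigs, Fintype.card_subtype, nPos, nNeg,
    ← Finset.card_union_of_disjoint]
  · congr 1
    ext i
    simpa using ne_iff_gt_or_lt.symm
  · rw [Finset.disjoint_filter]
    exact fun i _ h => not_lt_of_gt h

/-! ### Lowest coefficients of characteristic polynomials -/

/-- For Hermitian `M` the zero root of the characteristic polynomial has multiplicity exactly `n -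
rank`. The next coefficient is the product of the `-λᵢ` with `λᵢ ≠ 0`, whose negative factors are
the positive eigenvalues. -/
theorem coeff_charpoly_of_rank {n : ℕ} {M : Matrix (Fin n) (Fin n) ℂ} (hM : M.IsHermitian) :
    (∀ j < n - M.rank, M.charpoly.coeff j = 0) ∧
      ∃ c : ℝ, 0 < c ∧ M.charpoly.coeff (n - M.rank) = (-1) ^ nPos hM * (c : ℂ) := by
  set S : Finset (Fin n) := Finset.univ.filter fun i => hM.eigenvalues i ≠ 0 with hS
  have hcS : S.card = M.rank := by
    rw [hM.rank_eq_card_non_zero_eigs, Fintype.card_subtype]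
  have hcard : (Finset.univ.filter fun i => ¬ hM.eigenvalues i ≠ 0).card = n - M.rank := by
    have := Finset.card_filter_add_card_filter_not (s := (Finset.univ : Finset (Fin n)))
      (fun i => hM.eigenvalues i ≠ 0)
    rw [← hS, hcS, Finset.card_univ, Fintype.card_fin] at this
    omega
  have hch : M.charpoly = Polynomial.X ^ (n - M.rank) *
      ∏ i ∈ S, (Polynomial.X - Polynomial.C ((hM.eigenvalues i : ℝ) : ℂ)) := by
    have h0 := hM.charpoly_eq
    rw [h0, ← Finset.prod_filter_mul_prod_filter_not Finset.univ
      (fun i => hM.eigenvalues i ≠ 0), mul_comm, ← hcard]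
    congr 1
    rw [Finset.prod_congr rfl (g := fun _ => Polynomial.X), Finset.prod_const]
    intro i hi
    have : hM.eigenvalues i = 0 := by simpa using hi
    simp [this]
  refine ⟨fun j hj => ?_, ∏ i ∈ S, |hM.eigenvalues i|, ?_, ?_⟩
  · rw [hch, Polynomial.coeff_X_pow_mul', if_neg (not_le.2 hj)]
  · exact Finset.prod_pos fun i hi => abs_pos.2 (by simpa [hS] using hi)
  · rw [hch, Polynomial.coeff_X_pow_mul', if_pos le_rfl, Nat.sub_self,
      Polynomial.coeff_zero_eq_eval_zero, Polynomial.eval_prod]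
    have hP : nPos hM = (S.filter fun i => 0 < hM.eigenvalues i).card := by
      rw [nPos, hS, Finset.filter_filter]
      congr 1
      ext i
      simpa using fun h : 0 < hM.eigenvalues i => h.ne'
    rw [hP, ← Finset.prod_const, Finset.prod_filter (fun i => 0 < hM.eigenvalues i), Complex.ofReal_prod,
      ← Finset.prod_mul_distrib]
    refine Finset.prod_congr rfl fun i _ => ?_
    split_ifs with h
    · simp [abs_of_pos h]
    · simp [abs_of_nonpos (not_lt.1 h)]

open Polynomial in
theorem charpoly_pencilMatrix_map_eval {n : ℕ} (A B : Matrix (Fin n) (Fin n) ℂ) (z : ℂ) :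
    (pencilMatrix A B).charpoly.map (evalRingHom z) = (A - z • B).charpoly := by
  rw [← Matrix.charpoly_map]
  congr 1
  ext i j
  simp only [pencilMatrix, Matrix.map_apply, Matrix.sub_apply, Matrix.smul_apply, smul_eq_mul,
    coe_evalRingHom, eval_sub, eval_C, eval_mul, eval_X]

open Polynomial in
theorem eval_coeff_charpoly_pencilMatrix {n : ℕ} (A B : Matrix (Fin n) (Fin n) ℂ) (z : ℂ)
    (j : ℕ) : ((pencilMatrix A B).charpoly.coeff j).eval z = (A - z • B).charpoly.coeff j := by
  rw [← charpoly_pencilMatrix_map_eval, coeff_map]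
  rfl

/-! ### Normal rank and finiteness of the real spectrum -/

-- In rank normal form `A` has an identity block of size `rank A`. The corresponding minor of `A +
-- sB` is a polynomial in `s` with value 1 at `s = 0`, and the rank can drop only at its roots.
open Polynomial in
theorem finite_rank_add_smul_lt {n : ℕ} (A B : Matrix (Fin n) (Fin n) ℂ) :
    {s : ℂ | (A + s • B).rank < A.rank}.Finite := by
  obtain ⟨V, U, e, -, -, h⟩ := Matrix.exists_rank_normal_form A
  let i : Fin A.rank → Fin n := fun x => e.symm (Sum.inl x)
  let f : ℂ[X] := (((V * A * U).map C + (X : ℂ[X]) • (V * B * U).map C).submatrix i i).det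
  have hf : ∀ s, f.eval s = ((V * (A + s • B) * U).submatrix i i).det := by
    intro s
    have h1 : f.eval s = evalRingHom s f := rfl
    rw [h1, RingHom.map_det]
    congr 1
    ext x y
    simp only [RingHom.mapMatrix_apply, Matrix.map_apply, Matrix.submatrix_apply,
      Matrix.add_apply, Matrix.smul_apply, Matrix.mul_add, Matrix.add_mul, Matrix.mul_smul,
      Matrix.smul_mul, coe_evalRingHom, eval_add, eval_C, smul_eq_mul, eval_mul, eval_X]
  have hf0 : f ≠ 0 := by
    intro h0
    have h1 := hf 0
    rw [h0, eval_zero, zero_smul, add_zero, h, Matrix.submatrix_submatrix] at h1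
    have h2 : ((Matrix.fromBlocks 1 0 0 0 :
        Matrix (Fin A.rank ⊕ Fin (Fintype.card (Fin n) - A.rank)) _ ℂ).submatrix
          (e ∘ i) (e ∘ i)) = 1 := by
      ext x y
      simp [i, Matrix.one_apply]
    rw [h2, Matrix.det_one] at h1
    exact zero_ne_one h1
  refine (f.rootSet_finite ℂ).subset fun s hs => ?_
  rw [mem_rootSet_of_ne hf0]
  by_contra hne
  have h1 : ((V * (A + s • B) * U).submatrix i i).det ≠ 0 := by
    rw [← hf]
    simpa using hne
  have h2 := Matrix.rank_of_det_ne_zero h1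
  have h3 := Matrix.rank_submatrix_le (V * (A + s • B) * U) i i
  have h4 := Matrix.rank_mul_le_left (V * (A + s • B)) U
  have h5 := Matrix.rank_mul_le_right V (A + s • B)
  rw [h2, Fintype.card_fin] at h3
  exact absurd hs (not_lt.2 (h3.trans (h4.trans h5)))

theorem bddAbove_range_rank_pencilAt {n : ℕ} (A B : Matrix (Fin n) (Fin n) ℂ) :
    BddAbove (Set.range fun z => (pencilAt A B z).rank) :=
  ⟨n, by rintro _ ⟨z, rfl⟩; exact Matrix.rank_le_width _⟩

theorem rank_pencilAt_le_normalRank {n : ℕ} (A B : Matrix (Fin n) (Fin n) ℂ) (z : OnePoint ℂ) :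
    (pencilAt A B z).rank ≤ normalRank A B :=
  le_ciSup (bddAbove_range_rank_pencilAt A B) z

theorem exists_rank_pencilAt_eq_normalRank {n : ℕ} (A B : Matrix (Fin n) (Fin n) ℂ) :
    ∃ z, (pencilAt A B z).rank = normalRank A B :=
  Nat.sSup_mem (Set.range_nonempty _) (bddAbove_range_rank_pencilAt A B)

theorem normalRank_le {n : ℕ} (A B : Matrix (Fin n) (Fin n) ℂ) : normalRank A B ≤ n := by
  obtain ⟨z, hz⟩ := exists_rank_pencilAt_eq_normalRank A B
  exact hz ▸ Matrix.rank_le_width _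

theorem rank_sub_smul_le_normalRank {n : ℕ} (A B : Matrix (Fin n) (Fin n) ℂ) (z : ℂ) :
    (A - z • B).rank ≤ normalRank A B :=
  rank_pencilAt_le_normalRank A B (z : OnePoint ℂ)

theorem rank_le_normalRank_right {n : ℕ} (A B : Matrix (Fin n) (Fin n) ℂ) :
    B.rank ≤ normalRank A B :=
  rank_pencilAt_le_normalRank A B OnePoint.infty

theorem finite_setOf_isPencilEigenvalue {n : ℕ} (A B : Matrix (Fin n) (Fin n) ℂ) :
    {t : ℝ | IsPencilEigenvalue A B ((t : ℂ) : OnePoint ℂ)}.Finite := by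
  obtain ⟨z, hz⟩ := exists_rank_pencilAt_eq_normalRank A B
  induction z using OnePoint.rec with
  | infty =>
    have h1 := (finite_rank_add_smul_lt B A).preimage
      (f := fun t : ℝ => -(t : ℂ)⁻¹) (fun s _ t _ h => by simpa using h)
    refine (h1.union (Set.finite_singleton 0)).subset fun t ht => ?_
    by_cases ht0 : t = 0
    · exact Or.inr ht0
    · left
      have ht0' : (t : ℂ) ≠ 0 := by exact_mod_cast ht0
      -- If the maximal rank is attained at infinity, the chart `s = -1/t` reduces to a perturbation
      -- of `B`.
      have h2 : A - (t : ℂ) • B = (-(t : ℂ)) • (B + (-(t : ℂ)⁻¹) • A) := by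
        rw [smul_add, smul_smul, neg_mul_neg, mul_inv_cancel₀ ht0', one_smul, neg_smul,
          neg_add_eq_sub]
      have h3 : (A - (t : ℂ) • B).rank < normalRank A B := ht
      rw [h2, Matrix.rank_smul_of_mem_nonZeroDivisors _
        (mem_nonZeroDivisors_of_ne_zero (neg_ne_zero.2 ht0')), ← hz] at h3
      exact h3
  | coe z =>
    refine ((finite_rank_add_smul_lt (A - z • B) B).preimage
      (f := fun t : ℝ => z - (t : ℂ)) (fun s _ t _ h => by simpa using h)).subset fun t ht => ?_
    have h3 : (A - (t : ℂ) • B).rank < normalRank A B := ht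
    rw [← hz] at h3
    have h4 : A - z • B + (z - (t : ℂ)) • B = A - (t : ℂ) • B := by
      rw [sub_smul]
      abel
    show (A - z • B + (z - (t : ℂ)) • B).rank < (A - z • B).rank
    rw [h4]
    exact h3

/-! ### The product of eigenfunctions: sign, degree, order of zeros -/

section Hermitian

variable {n : ℕ} {A B : Matrix (Fin n) (Fin n) ℂ}

theorem eval_coeff_normalRank_ne_zero (hA : A.IsHermitian) (hB : B.IsHermitian) {t : ℝ}
    (ht : ¬ IsPencilEigenvalue A B ((t : ℂ) : OnePoint ℂ)) :
    ∃ c : ℝ, 0 < c ∧ ((pencilMatrix A B).charpoly.coeff (n - normalRank A B)).eval (t : ℂ) =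
      (-1) ^ nPos (isHermitian_pencil hA hB t) * (c : ℂ) := by
  have h1 : (A - (t : ℂ) • B).rank = normalRank A B :=
    le_antisymm (rank_sub_smul_le_normalRank A B t) (not_lt.1 ht)
  rw [eval_coeff_charpoly_pencilMatrix, ← h1]
  exact (coeff_charpoly_of_rank (isHermitian_pencil hA hB t)).2

theorem eigenfunctionProd_eq (hA : A.IsHermitian) (hB : B.IsHermitian) :
    eigenfunctionProd A B = (pencilMatrix A B).charpoly.coeff (n - normalRank A B) := by
  set p := (pencilMatrix A B).charpoly with hp
  have hq0 : p.coeff (n - normalRank A B) ≠ 0 := by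
    obtain ⟨t, ht⟩ := (finite_setOf_isPencilEigenvalue A B).infinite_compl.nonempty
    obtain ⟨c, hc, h⟩ := eval_coeff_normalRank_ne_zero hA hB ht
    intro h0
    rw [← hp, h0, Polynomial.eval_zero] at h
    simp [hc.ne'] at h
  have hlow : ∀ j < n - normalRank A B, p.coeff j = 0 := by
    intro j hj
    refine Polynomial.eq_zero_of_infinite_isRoot _
      (Set.Infinite.mono ?_ (Set.infinite_range_of_injective Complex.ofReal_injective))
    rintro _ ⟨s, rfl⟩
    show (p.coeff j).eval (s : ℂ) = 0
    rw [eval_coeff_charpoly_pencilMatrix]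
    refine (coeff_charpoly_of_rank (isHermitian_pencil hA hB s)).1 j ?_
    have := rank_sub_smul_le_normalRank A B s
    omega
  have hdeg : p.natTrailingDegree = n - normalRank A B :=
    le_antisymm (Polynomial.natTrailingDegree_le_of_ne_zero hq0)
      (Polynomial.le_natTrailingDegree (fun h => hq0 (by simp [h])) fun j hj => hlow j hj)
  rw [eigenfunctionProd, Polynomial.trailingCoeff, ← hp, hdeg]

/-- At a real point that is not an eigenvalue, the sign of the product of the eigenfunctions is
given by the number of positive eigenvalues. -/
theorem eval_eigenfunctionProd (hA : A.IsHermitian) (hB : B.IsHermitian) {t : ℝ}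
    (ht : ¬ IsPencilEigenvalue A B ((t : ℂ) : OnePoint ℂ)) :
    ∃ c : ℝ, 0 < c ∧ (eigenfunctionProd A B).eval (t : ℂ) =
      (-1) ^ nPos (isHermitian_pencil hA hB t) * (c : ℂ) := by
  rw [eigenfunctionProd_eq hA hB]
  exact eval_coeff_normalRank_ne_zero hA hB ht

theorem eigenfunctionProd_ne_zero (A B : Matrix (Fin n) (Fin n) ℂ) :
    eigenfunctionProd A B ≠ 0 := by
  exact Polynomial.trailingCoeff_nonzero_iff_nonzero.2 (Matrix.charpoly_monic _).ne_zero

theorem algMult_eq_zero (hA : A.IsHermitian) (hB : B.IsHermitian) {t : ℝ}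
    (ht : ¬ IsPencilEigenvalue A B ((t : ℂ) : OnePoint ℂ)) : algMult A B t = 0 := by
  obtain ⟨c, hc, h⟩ := eval_eigenfunctionProd hA hB ht
  refine Polynomial.rootMultiplicity_eq_zero fun h0 => ?_
  rw [h0.eq_zero] at h
  simp [hc.ne'] at h

/-- The coefficient of `x ^ (n - r)` in a characteristic polynomial is homogeneous of degree `r` in
the matrix entries, and here the entries have degree at most 1 in `z`. -/
theorem natDegree_eigenfunctionProd_le (hA : A.IsHermitian) (hB : B.IsHermitian) :
    (eigenfunctionProd A B).natDegree ≤ normalRank A B := by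
  have hr := normalRank_le A B
  have h1 := Matrix.charpoly.univ_coeff_isHomogeneous ℂ (Fin n) (n - normalRank A B)
    (normalRank A B) (by simp; omega)
  have h2 := Matrix.charpoly.univ_coeff_eval₂Hom (Fin n) Polynomial.C
    (fun ij => pencilMatrix A B ij.1 ij.2) (n - normalRank A B)
  have h3 := MvPolynomial.aeval_natDegree_le (n := 1) _ h1.totalDegree_le
    (fun ij => pencilMatrix A B ij.1 ij.2) (fun ij => by
      simp only [pencilMatrix, Matrix.sub_apply, Matrix.map_apply, Matrix.smul_apply, smul_eq_mul]
      compute_degree)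
  rw [mul_one] at h3
  rw [eigenfunctionProd_eq hA hB]
  exact (congrArg Polynomial.natDegree h2).symm.le.trans h3

open Polynomial in
/-- The algebraic multiplicity is at least the geometric multiplicity. -/
theorem normalRank_sub_rank_le_algMult (hA : A.IsHermitian) (hB : B.IsHermitian) (t : ℝ) :
    normalRank A B - (A - (t : ℂ) • B).rank ≤ algMult A B t := by
  classical
  set hM := isHermitian_pencil hA hB t
  set U : Matrix (Fin n) (Fin n) ℂ := (hM.eigenvectorUnitary : Matrix (Fin n) (Fin n) ℂ)
  set W := eigenCoords hM
  set s : ℂ[X] := X - C (t : ℂ) with hs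
  set D : Fin n → ℂ := fun i => ((hM.eigenvalues i : ℝ) : ℂ) with hD
  -- In an eigenbasis of `A - tB` the pencil is `D - s B'` with `s = z - t`, so the rows with `D i =
  -- 0` are divisible by `s`.
  have hpen : W.map C * pencilMatrix A B * U.map C =
      (Matrix.diagonal D).map C - s • (W * B * U).map C := by
    have h1 : pencilMatrix A B = (A - (t : ℂ) • B).map C - s • B.map C := by
      ext i j : 1
      simp only [pencilMatrix, hs, Matrix.sub_apply, Matrix.map_apply, Matrix.smul_apply,
        smul_eq_mul, C_sub, C_mul]
      ring
    have h2 : Matrix.diagonal D = W * (A - (t : ℂ) • B) * U := by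
      conv_rhs => rw [eq_mul_diagonal_mul hM]
      rw [Matrix.mul_assoc, Matrix.mul_assoc _ _ U, eigenCoords_mul, Matrix.mul_one,
        ← Matrix.mul_assoc, eigenCoords_mul, Matrix.one_mul]
    rw [h1, h2, Matrix.mul_sub, Matrix.sub_mul, Matrix.mul_smul, Matrix.smul_mul]
    simp only [Matrix.map_mul]
  set p := (pencilMatrix A B).charpoly with hp
  have hchar : p = ((Matrix.diagonal D).map C - s • (W * B * U).map C).charpoly := by
    rw [← hpen, Matrix.charpoly_mul_comm, ← Matrix.mul_assoc, ← Matrix.map_mul, mul_eigenCoords,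
      Matrix.map_one _ C_0 C_1, Matrix.one_mul]
  set v : Fin n → ℂ[X] := fun i => if D i = 0 then s else 1 with hv
  -- Replacing `x` by `s x` makes those rows of the characteristic matrix divisible by `s` as well;
  -- one factor is pulled out of each.
  have hrow : p.comp (C s * X) = (∏ i, C (v i)) * (Matrix.of fun i j : Fin n =>
      (if D i = 0 then (if i = j then X else 0) + C (C ((W * B * U) i j)) else
        (if i = j then C s * X - C (C (D i)) else 0) + C (s * C ((W * B * U) i j)) :
          ℂ[X][X])).det := by
    have h1 : p.comp (C s * X) = compRingHom (C s * X) p := rfl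
    rw [h1, hchar, Matrix.charpoly, RingHom.map_det, ← Matrix.det_mul_column]
    congr 1
    ext i j : 1
    simp only [RingHom.mapMatrix_apply, Matrix.map_apply, Matrix.charmatrix_apply, Matrix.of_apply,
      Matrix.sub_apply, Matrix.smul_apply, smul_eq_mul, Matrix.diagonal_apply, hv,
      coe_compRingHom_apply]
    split_ifs with h1 h2 h2 <;> simp [h2, mul_add, sub_add]
  have hprod : ∏ i, C (v i) = C (s ^ (n - (A - (t : ℂ) • B).rank)) := by
    rw [← map_prod, hv, Finset.prod_ite, Finset.prod_const, Finset.prod_const_one, mul_one]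
    congr 2
    rw [hM.rank_eq_card_non_zero_eigs, Fintype.card_subtype]
    have := Finset.card_filter_add_card_filter_not (s := (Finset.univ : Finset (Fin n)))
      (fun i => hM.eigenvalues i = 0)
    rw [Finset.card_univ, Fintype.card_fin] at this
    simp only [hD, Complex.ofReal_eq_zero]
    simp only [ne_eq]
    omega
  have hdvd : C (s ^ (n - (A - (t : ℂ) • B).rank)) ∣ p.comp (C s * X) :=
    ⟨_, by rw [hrow, hprod]⟩
  have h1 := C_dvd_iff_dvd_coeff _ _ |>.1 hdvd (n - normalRank A B)
  -- The substitution multiplies the coefficient of `x ^ (n - r)` by `s ^ (n - r)`; cancelling this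
  -- leaves `s ^ (r - rank)` dividing `q`.
  rw [comp_C_mul_X_coeff, ← eigenfunctionProd_eq hA hB] at h1
  have h2 := rank_sub_smul_le_normalRank A B t
  have h3 := normalRank_le A B
  have h4 : n - (A - (t : ℂ) • B).rank =
      (normalRank A B - (A - (t : ℂ) • B).rank) + (n - normalRank A B) := by omega
  rw [h4, pow_add] at h1
  rw [algMult, le_rootMultiplicity_iff (eigenfunctionProd_ne_zero A B)]
  exact (mul_dvd_mul_iff_right (pow_ne_zero _ (X_sub_C_ne_zero _))).1 h1

end Hermitian

/-! ### From local to global on the real line; parity of root counts -/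

/-- A reflexive transitive relation on `ℝ` that holds locally on both sides of each point holds
for all `a ≤ b`. -/
theorem rel_of_local {R : ℝ → ℝ → Prop} (hrefl : ∀ x, R x x)
    (htrans : ∀ x y z, x ≤ y → y ≤ z → R x y → R y z → R x z)
    (hloc : ∀ c, ∀ᶠ t in nhds c, (t ≤ c → R t c) ∧ (c ≤ t → R c t)) {a b : ℝ} (hab : a ≤ b) :
    R a b := by
  set S : Set ℝ := {x | a ≤ x ∧ x ≤ b ∧ R a x} with hS
  have haS : a ∈ S := ⟨le_rfl, hab, hrefl a⟩
  have hbdd : BddAbove S := ⟨b, fun x hx => hx.2.1⟩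
  have hσa : a ≤ sSup S := le_csSup hbdd haS
  have hσb : sSup S ≤ b := csSup_le ⟨a, haS⟩ fun x hx => hx.2.1
  obtain ⟨ε, hε, h⟩ := Metric.eventually_nhds_iff.1 (hloc (sSup S))
  obtain ⟨x, hxS, hx⟩ := exists_lt_of_lt_csSup ⟨a, haS⟩ (sub_lt_self (sSup S) hε)
  have hxσ : x ≤ sSup S := le_csSup hbdd hxS
  have h1 : R a (sSup S) := htrans a x _ hxS.1 hxσ hxS.2.2
    ((h (by rw [Real.dist_eq, abs_lt]; constructor <;> linarith)).1 hxσ)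
  rcases hσb.eq_or_lt with h2 | h2
  · rwa [h2] at h1
  · have h3 : sSup S < min b (sSup S + ε / 2) := lt_min h2 (by linarith)
    have h4 : min b (sSup S + ε / 2) ≤ sSup S + ε / 2 := min_le_right _ _
    have h5 : R a (min b (sSup S + ε / 2)) := htrans a _ _ hσa h3.le h1
      ((h (by rw [Real.dist_eq, abs_lt]; constructor <;> linarith)).2 h3.le)
    exact absurd (le_csSup hbdd (⟨hσa.trans h3.le, min_le_left _ _, h5⟩ : _ ∈ S)) (not_le.2 h3)

/-- If an integer function increases by at most `w c` near each point `c`, where `w` is supported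
on a finite set, then its total variation between points outside that set is bounded by the sum
of the `w c`. -/
theorem abs_sub_le_sum_of_local {f : ℝ → ℤ} {w : ℝ → ℤ} (Z : Finset ℝ) (hw : ∀ c, 0 ≤ w c)
    (hZ : ∀ c ∉ Z, w c = 0) (hloc : ∀ c, ∀ᶠ t in nhds c, f c ≤ f t ∧ f t ≤ f c + w c)
    {a b : ℝ} (hab : a ≤ b) (ha : a ∉ Z) (hb : b ∉ Z) :
    |f a - f b| ≤ ∑ c ∈ Z with a < c ∧ c < b, w c := by
  -- Half-open ranges make the sums additive under concatenation: a rise to the right of `c` is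
  -- charged to the left endpoint, a fall into `c` to the right one. They agree with the open range
  -- when the endpoints avoid `Z`.
  let R : ℝ → ℝ → Prop := fun s t => f t ≤ f s + ∑ c ∈ Z with s ≤ c ∧ c < t, w c ∧
    f s ≤ f t + ∑ c ∈ Z with s < c ∧ c ≤ t, w c
  have hsum : ∀ P : ℝ → Prop, ∀ [DecidablePred P], 0 ≤ ∑ c ∈ Z with P c, w c :=
    fun P _ => Finset.sum_nonneg fun c _ => hw c
  have hsingle : ∀ P : ℝ → Prop, ∀ [DecidablePred P], ∀ c, P c → w c ≤ ∑ c ∈ Z with P c, w c := by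
    intro P _ c hc
    by_cases h : c ∈ Z
    · exact Finset.single_le_sum (f := w) (fun c _ => hw c) (Finset.mem_filter.2 ⟨h, hc⟩)
    · rw [hZ c h]
      exact hsum P
  have hR : R a b := by
    refine rel_of_local (fun x => ?_) (fun x y z hxy hyz h1 h2 => ?_) (fun c => ?_) hab
    · exact ⟨le_add_of_nonneg_right (hsum _), le_add_of_nonneg_right (hsum _)⟩
    · have e1 : ∑ c ∈ Z with x ≤ c ∧ c < z, w c =
          ∑ c ∈ Z with x ≤ c ∧ c < y, w c + ∑ c ∈ Z with y ≤ c ∧ c < z, w c := by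
        rw [← Finset.sum_union]
        · refine Finset.sum_congr ?_ fun _ _ => rfl
          ext c
          simp only [Finset.mem_filter, Finset.mem_union]
          grind
        · rw [Finset.disjoint_filter]
          grind
      have e2 : ∑ c ∈ Z with x < c ∧ c ≤ z, w c =
          ∑ c ∈ Z with x < c ∧ c ≤ y, w c + ∑ c ∈ Z with y < c ∧ c ≤ z, w c := by
        rw [← Finset.sum_union]
        · refine Finset.sum_congr ?_ fun _ _ => rfl
          ext c
          simp only [Finset.mem_filter, Finset.mem_union]
          grind
        · rw [Finset.disjoint_filter]
          grind
      obtain ⟨h11, h12⟩ := h1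
      obtain ⟨h21, h22⟩ := h2
      constructor
      · rw [e1]; linarith
      · rw [e2]; linarith
    · filter_upwards [hloc c] with t ht
      refine ⟨fun h => ⟨?_, ?_⟩, fun h => ⟨?_, ?_⟩⟩
      · exact ht.1.trans (le_add_of_nonneg_right (hsum _))
      · rcases h.eq_or_lt with rfl | h
        · exact le_add_of_nonneg_right (hsum _)
        · exact ht.2.trans (add_le_add_right (hsingle _ c ⟨h, le_rfl⟩) _)
      · rcases h.eq_or_lt with rfl | h
        · exact le_add_of_nonneg_right (hsum _)
        · exact ht.2.trans (add_le_add_right (hsingle _ c ⟨le_rfl, h⟩) _)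
      · exact ht.1.trans (le_add_of_nonneg_right (hsum _))
  obtain ⟨h1, h2⟩ := hR
  have e1 : (Z.filter fun c => a ≤ c ∧ c < b) = Z.filter fun c => a < c ∧ c < b :=
    Finset.filter_congr fun c hc => by
      have : a ≠ c := fun h => ha (h ▸ hc)
      simp [this.le_iff_lt]
  have e2 : (Z.filter fun c => a < c ∧ c ≤ b) = Z.filter fun c => a < c ∧ c < b :=
    Finset.filter_congr fun c hc => by
      have : c ≠ b := fun h => hb (h ▸ hc)
      simp [this.le_iff_lt]
  rw [e1] at h1
  rw [e2] at h2
  rw [abs_le]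
  constructor <;> linarith

open Polynomial in
theorem exists_eq_prod_mul_of_roots {q : ℂ[X]} (hq : q ≠ 0) (Z : Finset ℝ)
    (hZ : ∀ t : ℝ, q.IsRoot t → t ∈ Z) :
    ∃ g : ℂ[X], q = (∏ c ∈ Z, (X - C (c : ℂ)) ^ q.rootMultiplicity (c : ℂ)) * g ∧
      ∀ t : ℝ, g.eval (t : ℂ) ≠ 0 := by
  obtain ⟨g, hg⟩ : (∏ c ∈ Z, (X - C (c : ℂ)) ^ q.rootMultiplicity (c : ℂ)) ∣ q := by
    refine Finset.prod_dvd_of_coprime (fun c _ d _ hcd => ?_)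
      fun c _ => pow_rootMultiplicity_dvd q _
    exact (pairwise_coprime_X_sub_C Complex.ofReal_injective hcd).pow
  refine ⟨g, hg, fun t ht => ?_⟩
  have htZ : t ∈ Z := hZ t (by rw [IsRoot, hg, eval_mul, ht, mul_zero])
  obtain ⟨g', rfl⟩ := dvd_iff_isRoot.2 ht
  obtain ⟨u, hu⟩ := Finset.dvd_prod_of_mem
    (fun c : ℝ => (X - C (c : ℂ)) ^ q.rootMultiplicity (c : ℂ)) htZ
  refine pow_rootMultiplicity_not_dvd hq (t : ℂ) ⟨u * g', ?_⟩
  conv_lhs => rw [hg, hu]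
  ring

open Polynomial in
/-- If the sign of a polynomial at its real non-roots is `(-1) ^ σ t`, then the number of its roots
between two real non-roots, counted with multiplicity, has the parity of the change of `σ`. -/
theorem even_sum_rootMultiplicity_add {q : ℂ[X]} (hq : q ≠ 0) (Z : Finset ℝ) (σ : ℝ → ℕ)
    (hσ : ∀ t : ℝ, t ∉ Z → ∃ c : ℝ, 0 < c ∧ q.eval (t : ℂ) = (-1) ^ σ t * (c : ℂ)) {a b : ℝ}
    (hab : a < b) (ha : a ∉ Z) (hb : b ∉ Z) :
    Even (∑ c ∈ Z with a < c ∧ c < b, q.rootMultiplicity (c : ℂ) + (σ a + σ b)) := by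
  obtain ⟨g, hg, hg0⟩ := exists_eq_prod_mul_of_roots hq Z fun t ht => by
    by_contra h
    obtain ⟨c, hc, h1⟩ := hσ t h
    rw [ht.eq_zero] at h1
    simp [hc.ne'] at h1
  set w : ℝ → ℕ := fun c => q.rootMultiplicity (c : ℂ)
  set P : ℝ → ℝ := fun t => ∏ c ∈ Z, (t - c) ^ w c with hP
  have hev : ∀ t : ℝ, q.eval (t : ℂ) = (P t : ℂ) * g.eval (t : ℂ) := by
    intro t
    conv_lhs => rw [hg]
    simp [eval_prod, hP, w]
  have hP0 : ∀ t ∉ Z, P t ≠ 0 := fun t ht =>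
    Finset.prod_ne_zero_iff.2 fun c hc => pow_ne_zero _ (sub_ne_zero.2 fun h => ht (h ▸ hc))
  have hcont : Continuous fun t : ℝ => g.eval (t : ℂ) :=
    g.continuous.comp Complex.continuous_ofReal
  -- Off `Z` both `q` and `P` are real and `P` is nonzero, so `g` is real on a dense set, hence on
  -- all of `ℝ`.
  have him : ∀ t : ℝ, (g.eval (t : ℂ)).im = 0 := by
    have hcl : IsClosed {t : ℝ | (g.eval (t : ℂ)).im = 0} :=
      isClosed_eq (Complex.continuous_im.comp hcont) continuous_const
    have hd : Dense ((Z : Set ℝ)ᶜ) := Z.countable_toSet.dense_compl ℝ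
    have hsub : ((Z : Set ℝ)ᶜ) ⊆ {t : ℝ | (g.eval (t : ℂ)).im = 0} := by
      intro t ht
      obtain ⟨c, hc, h1⟩ := hσ t ht
      have h2 : (P t : ℂ) * g.eval (t : ℂ) = (((-1) ^ σ t * c : ℝ) : ℂ) := by
        rw [← hev, h1]
        push_cast
        rfl
      have h3 := congrArg Complex.im h2
      rw [Complex.im_ofReal_mul, Complex.ofReal_im] at h3
      exact (mul_eq_zero.1 h3).resolve_left (hP0 t ht)
    have := (hd.mono hsub).closure_eq
    rw [hcl.closure_eq] at this
    exact fun t => Set.eq_univ_iff_forall.1 this t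
  have hre0 : ∀ t : ℝ, (g.eval (t : ℂ)).re ≠ 0 := fun t h => hg0 t (Complex.ext h (him t))
  have hval : ∀ t ∉ Z, ∃ c : ℝ, 0 < c ∧ P t * (g.eval (t : ℂ)).re = (-1) ^ σ t * c := by
    intro t ht
    obtain ⟨c, hc, h1⟩ := hσ t ht
    refine ⟨c, hc, ?_⟩
    have h2 : (P t : ℂ) * g.eval (t : ℂ) = (((-1) ^ σ t * c : ℝ) : ℂ) := by
      rw [← hev, h1]
      push_cast
      rfl
    have h3 := congrArg Complex.re h2
    rwa [Complex.re_ofReal_mul, Complex.ofReal_re] at h3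
  -- Real without real zeros, `g` has constant sign, so the sign change of `q` comes from `P` alone.
  have hpos : 0 < (g.eval (a : ℂ)).re * (g.eval (b : ℂ)).re := by
    by_contra hneg
    have hrc : ContinuousOn (fun t : ℝ => (g.eval (t : ℂ)).re) (Set.uIcc a b) :=
      (Complex.continuous_re.comp hcont).continuousOn
    have h0 : (0 : ℝ) ∈ Set.uIcc (g.eval (a : ℂ)).re (g.eval (b : ℂ)).re := by
      rw [Set.mem_uIcc]
      rcases mul_nonpos_iff.1 (not_lt.1 hneg) with h | h
      · exact Or.inr h.symm
      · exact Or.inl h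
    obtain ⟨t, -, ht⟩ := intermediate_value_uIcc hrc h0
    exact hre0 t ht
  -- The factor `(a - c) * (b - c)` is negative exactly when `c` lies between `a` and `b`.
  have hPP : P a * P b = (-1) ^ (∑ c ∈ Z with a < c ∧ c < b, w c) *
      ∏ c ∈ Z, |(a - c) * (b - c)| ^ w c := by
    rw [← Finset.prod_pow_eq_pow_sum, Finset.prod_filter, hP, ← Finset.prod_mul_distrib,
      ← Finset.prod_mul_distrib]
    refine Finset.prod_congr rfl fun c _ => ?_
    rw [← mul_pow]
    split_ifs with h
    · rw [← mul_pow, abs_of_nonpos (mul_nonpos_of_nonpos_of_nonneg (by linarith) (by linarith))]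
      ring
    · rw [one_mul, abs_of_nonneg]
      rcases le_or_gt c a with h1 | h1
      · exact mul_nonneg (by linarith) (by linarith)
      · have h2 : b ≤ c := not_lt.1 fun h2 => h ⟨h1, h2⟩
        exact mul_nonneg_of_nonpos_of_nonpos (by linarith) (by linarith)
  have hpos2 : 0 < ∏ c ∈ Z, |(a - c) * (b - c)| ^ w c := Finset.prod_pos fun c hc =>
    pow_pos (abs_pos.2 (mul_ne_zero (sub_ne_zero.2 fun h : a = c => ha (h ▸ hc))
      (sub_ne_zero.2 fun h : b = c => hb (h ▸ hc)))) _
  obtain ⟨ca, hca, hea⟩ := hval a ha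
  obtain ⟨cb, hcb, heb⟩ := hval b hb
  by_contra hodd
  rw [Nat.not_even_iff_odd] at hodd
  have h1 : (-1 : ℝ) ^ (∑ c ∈ Z with a < c ∧ c < b, w c) * (-1) ^ (σ a + σ b) = -1 := by
    rw [← pow_add]
    exact hodd.neg_one_pow
  have h2 : (-1 : ℝ) ^ (σ a + σ b) * (-1) ^ (σ a + σ b) = 1 := by
    rw [← mul_pow]
    simp
  set E1 : ℝ := (-1 : ℝ) ^ (∑ c ∈ Z with a < c ∧ c < b, w c)
  set E2 : ℝ := (-1 : ℝ) ^ (σ a + σ b)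
  have h3 : E1 * (∏ c ∈ Z, |(a - c) * (b - c)| ^ w c) *
      ((g.eval (a : ℂ)).re * (g.eval (b : ℂ)).re) = E2 * (ca * cb) := by
    rw [← hPP]
    calc P a * P b * ((g.eval (a : ℂ)).re * (g.eval (b : ℂ)).re)
        = (P a * (g.eval (a : ℂ)).re) * (P b * (g.eval (b : ℂ)).re) := by ring
      _ = E2 * (ca * cb) := by rw [hea, heb]; simp only [E2, pow_add]; ring
  have h4 : -((∏ c ∈ Z, |(a - c) * (b - c)| ^ w c) *
      ((g.eval (a : ℂ)).re * (g.eval (b : ℂ)).re)) = ca * cb := by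
    linear_combination E2 * h3 - (∏ c ∈ Z, |(a - c) * (b - c)| ^ w c) *
      ((g.eval (a : ℂ)).re * (g.eval (b : ℂ)).re) * h1 + ca * cb * h2
  have h5 := mul_pos hpos2 hpos
  have h6 := mul_pos hca hcb
  linarith

/-! ### Counting real eigenvalues of the pencil -/

section

variable {n : ℕ} {A B : Matrix (Fin n) (Fin n) ℂ}

/-- The finite set of real eigenvalues of a pencil. -/
noncomputable def realEigenvalues (A B : Matrix (Fin n) (Fin n) ℂ) : Finset ℝ :=
  (finite_setOf_isPencilEigenvalue A B).toFinset

theorem mem_realEigenvalues {t : ℝ} :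
    t ∈ realEigenvalues A B ↔ IsPencilEigenvalue A B ((t : ℂ) : OnePoint ℂ) := by
  simp [realEigenvalues]

theorem nEig_eq_sum (A B : Matrix (Fin n) (Fin n) ℂ) (S : Set ℝ) [DecidablePred (· ∈ S)] :
    nEig A B S = ∑ t ∈ realEigenvalues A B with t ∈ S, algMult A B t := by
  rw [nEig, ← finsum_mem_coe_finset]
  refine finsum_mem_congr ?_ fun _ _ => rfl
  ext t
  simp [mem_realEigenvalues, and_comm]

theorem sum_algMult_le (hA : A.IsHermitian) (hB : B.IsHermitian) (T : Finset ℝ) :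
    ∑ t ∈ T, algMult A B t ≤ normalRank A B := by
  classical
  calc ∑ t ∈ T, algMult A B t
      = ∑ z ∈ T.image (fun t : ℝ => (t : ℂ)), (eigenfunctionProd A B).roots.count z := by
        rw [Finset.sum_image fun x _ y _ h => Complex.ofReal_injective h]
        exact Finset.sum_congr rfl fun t _ => (Polynomial.count_roots _).symm
    _ ≤ (eigenfunctionProd A B).roots.card := by
        rw [← Multiset.toFinset_sum_count_eq]
        refine Finset.sum_le_sum_of_ne_zero fun z _ hz => ?_
        rw [Multiset.mem_toFinset]
        exact Multiset.count_ne_zero.1 hz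
    _ ≤ _ := (Polynomial.card_roots' _).trans (natDegree_eigenfunctionProd_le hA hB)

theorem nEig_le (hA : A.IsHermitian) (hB : B.IsHermitian) (S : Set ℝ) :
    nEig A B S ≤ normalRank A B := by
  classical
  rw [nEig_eq_sum]
  exact sum_algMult_le hA hB _

theorem nPos_add_nNeg_of_not_isPencilEigenvalue (hA : A.IsHermitian) (hB : B.IsHermitian) {t : ℝ}
    (ht : ¬ IsPencilEigenvalue A B ((t : ℂ) : OnePoint ℂ)) :
    nPos (isHermitian_pencil hA hB t) + nNeg (isHermitian_pencil hA hB t) = normalRank A B := by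
  rw [nPos_add_nNeg]
  exact le_antisymm (rank_sub_smul_le_normalRank A B t) (not_lt.1 ht)

/-- The upper bound comes from semicontinuity of `n₋`: `n₊(t) ≤ r - n₋(t) ≤ r - n₋(c)`, which is
`n₊(c)` plus the rank drop at `c`. -/
theorem eventually_nPos_pencil (hA : A.IsHermitian) (hB : B.IsHermitian) (c : ℝ) :
    ∀ᶠ t in nhds c, nPos (isHermitian_pencil hA hB c) ≤ nPos (isHermitian_pencil hA hB t) ∧
      nPos (isHermitian_pencil hA hB t) ≤
        nPos (isHermitian_pencil hA hB c) + algMult A B c := by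
  have hcont : Continuous fun t : ℝ => A - (t : ℂ) • B :=
    continuous_const.sub (Complex.continuous_ofReal.smul continuous_const)
  filter_upwards [eventually_signCount_le _ hcont (isHermitian_pencil hA hB) 1 c,
    eventually_signCount_le _ hcont (isHermitian_pencil hA hB) (-1) c] with t h1 h2
  rw [← nPos_eq_signCount _ one_pos, ← nPos_eq_signCount _ one_pos] at h1
  rw [← nNeg_eq_signCount _ neg_one_lt_zero, ← nNeg_eq_signCount _ neg_one_lt_zero] at h2
  have h3 := nPos_add_nNeg (isHermitian_pencil hA hB t)
  have h4 := nPos_add_nNeg (isHermitian_pencil hA hB c)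
  have h5 := rank_sub_smul_le_normalRank A B t
  have h6 := normalRank_sub_rank_le_algMult hA hB c
  omega

theorem abs_nPos_sub_nPos_le_nEig (hA : A.IsHermitian) (hB : B.IsHermitian) {a b : ℝ}
    (hab : a < b) (ha : ¬ IsPencilEigenvalue A B ((a : ℂ) : OnePoint ℂ))
    (hb : ¬ IsPencilEigenvalue A B ((b : ℂ) : OnePoint ℂ)) :
    |(nPos (isHermitian_pencil hA hB a) : ℤ) - (nPos (isHermitian_pencil hA hB b) : ℤ)| ≤
      (nEig A B (Set.Ioo a b) : ℤ) := by
  have h := abs_sub_le_sum_of_local (f := fun t => (nPos (isHermitian_pencil hA hB t) : ℤ))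
    (w := fun t => (algMult A B t : ℤ)) (realEigenvalues A B) (fun c => Int.natCast_nonneg _)
    (fun c hc => by
      have := algMult_eq_zero hA hB fun h => hc (mem_realEigenvalues.2 h)
      exact_mod_cast this)
    (fun c => (eventually_nPos_pencil hA hB c).mono fun t ht => by exact_mod_cast ht)
    hab.le (fun h => ha (mem_realEigenvalues.1 h)) (fun h => hb (mem_realEigenvalues.1 h))
  rw [nEig_eq_sum]
  push_cast
  convert h using 2
  ext t
  simp

theorem even_nEig_add (hA : A.IsHermitian) (hB : B.IsHermitian) {a b : ℝ}
    (hab : a < b) (ha : ¬ IsPencilEigenvalue A B ((a : ℂ) : OnePoint ℂ))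
    (hb : ¬ IsPencilEigenvalue A B ((b : ℂ) : OnePoint ℂ)) :
    Even (nEig A B (Set.Ioo a b) +
      (nPos (isHermitian_pencil hA hB a) + nPos (isHermitian_pencil hA hB b))) := by
  have h := even_sum_rootMultiplicity_add (eigenfunctionProd_ne_zero A B) (realEigenvalues A B)
    (fun t => nPos (isHermitian_pencil hA hB t))
    (fun t ht => eval_eigenfunctionProd hA hB fun h => ht (mem_realEigenvalues.2 h)) hab
    (fun h => ha (mem_realEigenvalues.1 h)) (fun h => hb (mem_realEigenvalues.1 h))
  rw [nEig_eq_sum]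
  convert h using 3
  · ext t
    simp
  · rfl

theorem nEig_Ioo_add_le (hA : A.IsHermitian) (hB : B.IsHermitian) (a d : ℝ) {b c : ℝ}
    (hbc : b ≤ c) :
    nEig A B (Set.Ioo a b) + nEig A B (Set.Ioo b c) + nEig A B (Set.Ioo c d) ≤
      normalRank A B := by
  classical
  rw [nEig_eq_sum, nEig_eq_sum, nEig_eq_sum, ← Finset.sum_union, ← Finset.sum_union]
  · exact sum_algMult_le hA hB _
  · rw [Finset.disjoint_left]
    simp only [Finset.mem_union, Finset.mem_filter, Set.mem_Ioo]
    rintro t (h | h) h' <;> linarith [h.2.1, h.2.2, h'.2.1]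
  · rw [Finset.disjoint_filter]
    simp only [Set.mem_Ioo]
    intro t _ h h'
    linarith [h.2, h'.1]

theorem nEig_mono {S T : Set ℝ} (h : S ⊆ T) : nEig A B S ≤ nEig A B T := by
  classical
  rw [nEig_eq_sum, nEig_eq_sum]
  exact Finset.sum_le_sum_of_subset (Finset.monotone_filter_right _ fun t _ ht => h ht)

/-- The signature of `A - t B` for real `t` of large absolute value. -/
theorem eventually_inertia_pencil (hA : A.IsHermitian) (hB : B.IsHermitian) :
    ∀ᶠ T : ℝ in Filter.atTop,
      (nPos hB ≤ nNeg (isHermitian_pencil hA hB T) ∧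
        nNeg hB ≤ nPos (isHermitian_pencil hA hB T)) ∧
      (nPos hB ≤ nPos (isHermitian_pencil hA hB (-T)) ∧
        nNeg hB ≤ nNeg (isHermitian_pencil hA hB (-T))) := by
  have hcont : Continuous fun t : ℝ => B - (t : ℂ) • A :=
    continuous_const.sub (Complex.continuous_ofReal.smul continuous_const)
  have h0 : ∀ ε, signCount (isHermitian_pencil hB hA 0) ε = signCount hB ε := by
    intro ε
    congr 1
    simp
  have hev : ∀ᶠ s in nhds (0 : ℝ), nPos hB ≤ nPos (isHermitian_pencil hB hA s) ∧
      nNeg hB ≤ nNeg (isHermitian_pencil hB hA s) := by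
    filter_upwards [eventually_signCount_le _ hcont (isHermitian_pencil hB hA) 1 0,
      eventually_signCount_le _ hcont (isHermitian_pencil hB hA) (-1) 0] with s h1 h2
    rw [h0, ← nPos_eq_signCount _ one_pos, ← nPos_eq_signCount _ one_pos] at h1
    rw [h0, ← nNeg_eq_signCount _ neg_one_lt_zero, ← nNeg_eq_signCount _ neg_one_lt_zero] at h2
    exact ⟨h1, h2⟩
  -- From `A - TB = -T (B - T⁻¹ A)`: large `T` becomes a small perturbation of `B`, with the signs
  -- swapped when `T > 0`.
  have hsmul : ∀ T : ℝ, T ≠ 0 → ∀ ε, signCount (isHermitian_pencil hB hA T⁻¹) (ε * -T) ≤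
      signCount (isHermitian_pencil hA hB T) ε := by
    intro T hT ε
    refine signCount_le_of_eq_smul _ _ (-T) ε ?_
    have hT' : (T : ℂ) ≠ 0 := by exact_mod_cast hT
    rw [smul_sub, smul_smul, Complex.ofReal_neg, Complex.ofReal_inv, neg_mul,
      mul_inv_cancel₀ hT', neg_smul, neg_smul, one_smul, sub_neg_eq_add, neg_add_eq_sub]
  filter_upwards [tendsto_inv_atTop_zero.eventually hev,
    (tendsto_inv_atBot_zero.comp Filter.tendsto_neg_atTop_atBot).eventually hev,
    Filter.eventually_gt_atTop 0] with T h1 h2 hT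
  have hT' : -T < 0 := neg_lt_zero.2 hT
  refine ⟨⟨h1.1.trans ?_, h1.2.trans ?_⟩, h2.1.trans ?_, h2.2.trans ?_⟩
  · have := hsmul T hT.ne' (-1)
    rwa [← nPos_eq_signCount _ (by linarith), ← nNeg_eq_signCount _ neg_one_lt_zero] at this
  · have := hsmul T hT.ne' 1
    rwa [← nNeg_eq_signCount _ (by linarith), ← nPos_eq_signCount _ one_pos] at this
  · have := hsmul (-T) hT'.ne 1
    rwa [← nPos_eq_signCount _ (by linarith), ← nPos_eq_signCount _ one_pos] at this
  · have := hsmul (-T) hT'.ne (-1)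
    rwa [← nNeg_eq_signCount _ (by linarith), ← nNeg_eq_signCount _ neg_one_lt_zero] at this

theorem eventually_not_isPencilEigenvalue (A B : Matrix (Fin n) (Fin n) ℂ) :
    ∀ᶠ T : ℝ in Filter.atTop, ¬ IsPencilEigenvalue A B ((T : ℂ) : OnePoint ℂ) ∧
      ¬ IsPencilEigenvalue A B (((-T : ℝ) : ℂ) : OnePoint ℂ) := by
  have h := finite_setOf_isPencilEigenvalue A B
  obtain ⟨u, hu⟩ := h.bddAbove
  obtain ⟨l, hl⟩ := h.bddBelow
  filter_upwards [Filter.eventually_gt_atTop u, Filter.eventually_gt_atTop (-l)] with T h1 h2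
  refine ⟨fun h3 => ?_, fun h3 => ?_⟩
  · exact absurd (hu h3) (not_le.2 h1)
  · have := hl h3
    linarith

/-- For large `T`, `n₊(-T) - n₊(T) ≥ 2 n₊(B) - r` and `n₊(T) - n₊(-T) ≥ 2 n₋(B) - r`. Since `r =
n₊(B) + n₋(B) + g_∞`, these are the two signs of the absolute value. -/
theorem abs_signature_sub_geomMult_le_nEig (hA : A.IsHermitian) (hB : B.IsHermitian) :
    |(nPos hB : ℤ) - (nNeg hB : ℤ)| - (geomMult A B OnePoint.infty : ℤ)
      ≤ (nEig A B Set.univ : ℤ) := by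
  obtain ⟨T, ⟨⟨h1, h2⟩, h3, h4⟩, ⟨h5, h6⟩, hT⟩ := ((eventually_inertia_pencil hA hB).and
    ((eventually_not_isPencilEigenvalue A B).and (Filter.eventually_gt_atTop 0))).exists
  have h7 := abs_nPos_sub_nPos_le_nEig hA hB (by linarith : -T < T) h6 h5
  have h8 : nEig A B (Set.Ioo (-T) T) ≤ nEig A B Set.univ := nEig_mono (Set.subset_univ _)
  have h9 := nPos_add_nNeg_of_not_isPencilEigenvalue hA hB h5
  have h10 := nPos_add_nNeg_of_not_isPencilEigenvalue hA hB h6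
  have h11 : geomMult A B OnePoint.infty = normalRank A B - B.rank := rfl
  have h12 := nPos_add_nNeg hB
  have h13 := rank_le_normalRank_right A B
  rw [abs_le] at h7
  rw [h11, sub_le_iff_le_add, abs_le]
  omega

/-- Source of the bound `h ≤ k`: the jump bound on `(-T,a)` and `(b,T)` is a lower bound for the
eigenvalues outside `[a,b]`, and all three open intervals share at most `r`. -/
theorem nEig_Ioo_add_le_nPos_sub_nPos (hA : A.IsHermitian) (hB : B.IsHermitian) {a b : ℝ}
    (hab : a < b) (ha : ¬ IsPencilEigenvalue A B ((a : ℂ) : OnePoint ℂ))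
    (hb : ¬ IsPencilEigenvalue A B ((b : ℂ) : OnePoint ℂ)) :
    (nEig A B (Set.Ioo a b) : ℤ) + 2 * (nPos hB : ℤ) ≤
      (nPos (isHermitian_pencil hA hB a) : ℤ) - (nPos (isHermitian_pencil hA hB b) : ℤ) +
        2 * (normalRank A B : ℤ) := by
  obtain ⟨T, ⟨⟨h1, -⟩, h3, -⟩, ⟨h5, h6⟩, hTa, hTb⟩ := ((eventually_inertia_pencil hA hB).and
    ((eventually_not_isPencilEigenvalue A B).and ((Filter.eventually_gt_atTop (-a)).and
      (Filter.eventually_gt_atTop b)))).exists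
  have h7 := abs_nPos_sub_nPos_le_nEig hA hB (by linarith : -T < a) h6 ha
  have h8 := abs_nPos_sub_nPos_le_nEig hA hB hTb hb h5
  have h9 := nPos_add_nNeg_of_not_isPencilEigenvalue hA hB h5
  have h10 := nEig_Ioo_add_le hA hB (-T) T hab.le
  rw [abs_le] at h7 h8
  omega

end

theorem theorem4p3 {n k : ℕ} (A B : Matrix (Fin n) (Fin n) ℂ)
    (hA : A.IsHermitian) (hB : B.IsHermitian)
    (hk : nPos hB + k = n) (hnk : 2 * k ≤ n) :
    (∀ a b : ℝ, a < b →
      ¬ IsPencilEigenvalue A B ((a : ℂ) : OnePoint ℂ) →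
      ¬ IsPencilEigenvalue A B ((b : ℂ) : OnePoint ℂ) →
      ∃ h : ℕ, h ≤ k ∧
        (nEig A B (Set.Ioo a b) : ℤ) =
          |(nPos (isHermitian_pencil hA hB a) : ℤ) - (nPos (isHermitian_pencil hA hB b) : ℤ)|
            + 2 * (h : ℤ)) ∧
    (|(nPos hB : ℤ) - (nNeg hB : ℤ)| - (geomMult A B OnePoint.infty : ℤ)
        ≤ (nEig A B Set.univ : ℤ)) ∧
    (¬ IsPencilEigenvalue A B OnePoint.infty →
      |(nPos hB : ℤ) - (nNeg hB : ℤ)| ≤ (nEig A B Set.univ : ℤ)) ∧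
    nEig A B Set.univ ≤ n := by
  have hr := normalRank_le A B
  have hlow := abs_signature_sub_geomMult_le_nEig hA hB
  refine ⟨fun a b hab ha hb => ?_, hlow, fun h => ?_, (nEig_le hA hB _).trans hr⟩
  · have h1 := abs_nPos_sub_nPos_le_nEig hA hB hab ha hb
    have h2 := nEig_Ioo_add_le_nPos_sub_nPos hA hB hab ha hb
    obtain ⟨m, hm⟩ := even_nEig_add hA hB hab ha hb
    set x : ℤ := (nPos (isHermitian_pencil hA hB a) : ℤ) - (nPos (isHermitian_pencil hA hB b) : ℤ)
      with hx
    -- Neither truncation loses anything: the difference is nonnegative by the jump bound and even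
    -- by parity.
    refine ⟨((nEig A B (Set.Ioo a b) : ℤ) - |x|).toNat / 2, ?_, ?_⟩
    · have := le_abs_self x
      omega
    · rcases abs_cases x with ⟨h, -⟩ | ⟨h, -⟩ <;> rw [h] at h1 ⊢ <;> omega
  · have h1 : geomMult A B OnePoint.infty = 0 := Nat.sub_eq_zero_of_le (not_lt.1 h)
    simpa [h1] using hlow
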